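/- Let $K_n$ be the complete graph on the vertex set $\{1,\dots,n\}$, let $p(f)\in[0,1]$ for every edge $f$ of $K_n$, and let $G$ be the random graph that contains each edge $f$ of $K_n$ independently with probability $p(f)$. For $0<\alpha<1$, $c_1,c_2>0$ and $p>0$, the edge probabilities are called $(\alpha,c_1,c_2,p)$-good if for every vertex $u$ and every set $S$ of $r\ge \alpha n$ vertices with $u\notin S$, $$c_1 r p\le \sum_{v\in S}p(u,v)\le c_2 r p .$$ Theorem. Let $k\ge 1$ be an integer and let $0<\alpha<1$, $0<c_1\le c_2$ and $C>0$ be constants with $$C\le \frac{1}{10c_2}\quad\text{and}\quad \alpha\le\min\left(\frac78,\Big(\frac{Cc_1}{8}\Big)^{k+1}\right).$$ Then there is a constant $\theta>0$, depending only on $\alpha,c_1,c_2,C,k$, such that for every $n\ge 1$ and all edge probabilities that are $(\alpha,c_1,c_2,p)$-good with $p=Cn^{-k/(k+1)}$, $$\mathbb P(G\text{ has a Hamiltonian path})\ge 1-e^{-\theta np},$$ where a Hamiltonian path is a path that visits every vertex exactly once. -/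

import Mathlib

open MeasureTheory ProbabilityTheory

/-- The edges of the complete graph `K_n` on the vertex set `Fin n`. -/
abbrev KEdge (n : ℕ) : Type := (⊤ : SimpleGraph (Fin n)).edgeSet

/-- The assignment `q` of probabilities to the edges `s(u, v)` of `K_n` is
`(α, c₁, c₂, p)`-good: for every vertex `u` and every set `S` of `r ≥ α n` vertices (other than
`u`, as there are no loops in `K_n`), `c₁ r p ≤ ∑_{v ∈ S} q(u, v) ≤ c₂ r p`.
The values of `q` on the diagonal of `Sym2 (Fin n)` play no role. -/
def IsGoodAssignment {n : ℕ} (α c₁ c₂ p : ℝ) (q : Sym2 (Fin n) → ℝ) : Prop :=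
  ∀ (u : Fin n) (S : Finset (Fin n)), u ∉ S → α * (n : ℝ) ≤ (S.card : ℝ) →
    c₁ * (S.card : ℝ) * p ≤ ∑ v ∈ S, q s(u, v) ∧
      ∑ v ∈ S, q s(u, v) ≤ c₂ * (S.card : ℝ) * p

/-- The random variables `Z f`, for `f` an edge of `K_n`, are independent Bernoulli variables,
`Z f` being `true` with probability `q f`. -/
structure IsEdgeModel {n : ℕ} {Ω : Type*} [MeasurableSpace Ω] (μ : Measure Ω)
    (q : Sym2 (Fin n) → ℝ) (Z : KEdge n → Ω → Bool) : Prop where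
  measurable : ∀ f, Measurable (Z f)
  indep : iIndepFun Z μ
  law : ∀ f : KEdge n, μ.real {ω | Z f ω = true} = q f

/-- The graph on `Fin n` whose edges are the open edges `f`, those with `z f = true`. -/
def openGraph {n : ℕ} (z : KEdge n → Bool) : SimpleGraph (Fin n) :=
  SimpleGraph.fromEdgeSet {e | ∃ f : KEdge n, (f : Sym2 (Fin n)) = e ∧ z f = true}

/-- `G` has a Hamiltonian path: a walk that visits every vertex exactly once. -/
def HasHamiltonianPath {n : ℕ} (G : SimpleGraph (Fin n)) : Prop :=
  ∃ (a b : Fin n) (w : G.Walk a b), w.IsHamiltonian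

/-! Since `np = C n^(1/(k+1))` dominates `log n`, Pósa rotation works without any multi-round
exposure. A union bound shows that, except with small probability, every set of at most `n/8`
vertices has a large outer boundary (`measureReal_not_expands_le`). If there is no Hamiltonian path,
a longest path misses some `v`, hence is a longest path of `G - v`. By Pósa's lemma
(`exists_ends_boundary_le`), expansion forces more than `n/8` ends of longest paths in `G - v`, and
`v` is adjacent to none of them (`exists_nonadj`). These ends are determined by the edges avoiding
`v`, so the edges at `v` are independent of them and all missing with probability at most
`e^(-c₁np/8)` (`measureReal_ends_nonadj_le`).

This settles large `n`. For the finitely many other `n` a positive lower bound on the probability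
suffices, with `θ` small: the pairs with `q ≥ c₁p` form a dense graph, which has a Hamiltonian path
by the same expansion argument. -/

section Paths

/-! ### Paths as lists, rotations and Pósa's lemma -/

variable {V : Type*}

/-- `a` and `b` are neighbours, in either order, in the list. -/
def ListAdj (a b : V) : List V → Prop
  | x :: y :: l => (x = a ∧ y = b ∨ x = b ∧ y = a) ∨ ListAdj a b (y :: l)
  | _ => False

theorem listAdj_append (a b : V) (A B : List V) :
    ListAdj a b (A ++ B) ↔ ListAdj a b A ∨
      (∃ x ∈ A.getLast?, ∃ y ∈ B.head?, x = a ∧ y = b ∨ x = b ∧ y = a) ∨ ListAdj a b B := by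
  induction A with
  | nil => simp [ListAdj]
  | cons x A ih =>
    cases A with
    | nil => cases B <;> simp [ListAdj]
    | cons y A =>
      rw [List.cons_append, List.cons_append, ListAdj, ← List.cons_append, ih, ListAdj,
        List.getLast?_cons_cons]
      exact or_assoc.symm

theorem listAdj_reverse (a b : V) (l : List V) : ListAdj a b l.reverse ↔ ListAdj a b l := by
  induction l with
  | nil => simp
  | cons x l ih =>
    rw [List.reverse_cons, listAdj_append, ih]
    cases l with
    | nil => simp [ListAdj]
    | cons y l =>
      simp only [ListAdj, List.getLast?_reverse, List.head?_cons, Option.mem_def,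
        Option.some.injEq, exists_eq_left', or_false]
      tauto

theorem ListAdj.mem_left {a b : V} {l : List V} (h : ListAdj a b l) : a ∈ l := by
  induction l with
  | nil => exact h.elim
  | cons x l ih =>
    cases l with
    | nil => exact h.elim
    | cons y l =>
      rcases h with (⟨rfl, rfl⟩ | ⟨rfl, rfl⟩) | h
      · simp
      · simp
      · exact List.mem_cons_of_mem _ (ih h)

theorem ListAdj.symm {a b : V} {l : List V} (h : ListAdj a b l) : ListAdj b a l := by
  induction l with
  | nil => exact h.elim
  | cons x l ih =>
    cases l with
    | nil => exact h.elim
    | cons y l => exact h.imp (fun h => h.symm) ih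

theorem card_listAdj_le [Fintype V] [DecidableEq V] (x : V) {l : List V} (hl : l.Nodup)
    [DecidablePred fun w => ListAdj x w l] :
    (Finset.univ.filter fun w => ListAdj x w l).card ≤ 2 := by
  by_cases hx : x ∈ l
  · obtain ⟨s, t, rfl⟩ := List.append_of_mem hx
    have hs : x ∉ s := fun h => (List.disjoint_of_nodup_append hl) h (by simp)
    have ht : x ∉ t := (List.nodup_cons.1 hl.of_append_right).1
    refine (Finset.card_le_card
      (t := (s.getLast?.toList ++ t.head?.toList).toFinset) ?_).trans
      ((List.toFinset_card_le _).trans ?_)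
    · intro w hw
      simp only [Finset.mem_filter, Finset.mem_univ, true_and] at hw
      rw [listAdj_append, ← List.singleton_append, listAdj_append] at hw
      simp only [List.mem_toFinset, List.mem_append, Option.mem_toList]
      rcases hw with hw | ⟨a, ha, b, hb, hab⟩ | hw | ⟨a, ha, b, hb, hab⟩ | hw
      · exact (hs hw.mem_left).elim
      · rcases hab with ⟨rfl, rfl⟩ | ⟨rfl, rfl⟩
        · exact (hs (List.mem_of_getLast? ha)).elim
        · exact Or.inl ha
      · exact hw.elim
      · rcases hab with ⟨rfl, rfl⟩ | ⟨rfl, rfl⟩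
        · exact Or.inr hb
        · exact (ht (List.mem_of_head? hb)).elim
      · exact (ht hw.mem_left).elim
    · rw [List.length_append]
      have h1 : s.getLast?.toList.length ≤ 1 := by cases s.getLast? <;> simp
      have h2 : t.head?.toList.length ≤ 1 := by cases t.head? <;> simp
      omega
  · rw [Finset.filter_false_of_mem (fun w _ h => hx (ListAdj.mem_left h))]
    simp

/-- The list `l` is a path of `G` inside the vertex set `U`. -/
structure IsPathIn (G : SimpleGraph V) (U : Set V) (l : List V) : Prop where
  nodup : l.Nodup
  chain : l.IsChain G.Adj
  subset : ∀ x ∈ l, x ∈ U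

/-- The list `l` is a longest path of `G` inside the vertex set `U`. -/
structure IsLongestPathIn (G : SimpleGraph V) (U : Set V) (l : List V) : Prop
    extends IsPathIn G U l where
  length_le : ∀ l', IsPathIn G U l' → l'.length ≤ l.length

/-- The lists that arise from the path `P` by rotations that fix its last vertex. -/
inductive Rotated (G : SimpleGraph V) (P : List V) : List V → Prop
  | refl : Rotated G P P
  | step (A B : List V) (x y : V) (hx : A.head? = some x) (hxy : G.Adj x y)
      (h : Rotated G P (A ++ y :: B)) : Rotated G P (A.reverse ++ y :: B)

theorem IsPathIn.rotate {G : SimpleGraph V} {U : Set V} {A B : List V} {x y : V}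
    (h : IsPathIn G U (A ++ y :: B)) (hx : A.head? = some x) (hxy : G.Adj x y) :
    IsPathIn G U (A.reverse ++ y :: B) where
  nodup := ((A.reverse_perm.append_right _).nodup_iff).2 h.nodup
  chain := by
    have := h.chain
    rw [List.isChain_append] at this ⊢
    refine ⟨?_, this.2.1, ?_⟩
    · rw [List.isChain_reverse]
      exact this.1.imp fun a b hab => hab.symm
    · simp [hx, hxy]
  subset a ha := h.subset a (by simpa using ha)

theorem Rotated.isLongestPathIn {G : SimpleGraph V} {U : Set V} {P Q : List V}
    (hQ : Rotated G P Q) (hP : IsLongestPathIn G U P) : IsLongestPathIn G U Q := by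
  induction hQ with
  | refl => exact hP
  | step A B x y hx hxy _ ih =>
    exact ⟨ih.toIsPathIn.rotate hx hxy, fun l hl => by simpa using ih.length_le l hl⟩

/-- A vertex that is neither an endpoint of a rotated path nor next to one on the original path
keeps its neighbours under rotations. -/
theorem Rotated.listAdj_iff {G : SimpleGraph V} {P Q : List V} (hQ : Rotated G P Q) {w : V}
    (hw : ∀ Q', Rotated G P Q' → Q'.head? ≠ some w)
    (hN : ∀ Q' z, Rotated G P Q' → Q'.head? = some z → ¬ ListAdj w z P) (b : V) :
    ListAdj w b Q ↔ ListAdj w b P := by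
  induction hQ generalizing b with
  | refl => rfl
  | step A B x y hx hxy h ih =>
    rw [← ih]
    have h' := Rotated.step A B x y hx hxy h
    obtain ⟨z, hz⟩ : ∃ z, A.getLast? = some z := by
      cases A with
      | nil => simp at hx
      | cons a A => exact ⟨_, List.getLast?_eq_some_getLast (by simp)⟩
    have hz' : (A.reverse ++ y :: B).head? = some z := by simp [List.head?_append, hz]
    have hx' : (A ++ y :: B).head? = some x := by simp [List.head?_append, hx]
    have hwz : z ≠ w := fun e => hw _ h' (e ▸ hz')
    have hwx : x ≠ w := fun e => hw _ h (e ▸ hx')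
    -- The rotation breaks only the pair `z, y`, and makes `z` an endpoint. If `y = w`, then by
    -- induction `z` was already next to `w` on `P`, against `hN`.
    have hwy : y ≠ w := by
      rintro rfl
      refine hN _ z h' hz' ((ih z).1 ?_)
      rw [listAdj_append]
      exact Or.inr (Or.inl ⟨z, hz, y, by simp, by simp⟩)
    rw [listAdj_append, listAdj_append, listAdj_reverse]
    simp [hx, hz, hwz, hwx, hwy]

/-- The vertices that begin a longest path of `G` inside `U`. -/
def longestPathEnds (G : SimpleGraph V) (U : Set V) : Set V :=
  {x | ∃ l, IsLongestPathIn G U (x :: l)}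

theorem exists_isLongestPathIn [Fintype V] (G : SimpleGraph V) (U : Set V) :
    ∃ l, IsLongestPathIn G U l := by
  have hb : ∀ l, IsPathIn G U l → l.length ≤ Fintype.card V := fun l hl => hl.nodup.length_le_card
  let s : Set ℕ := {m | ∃ l, IsPathIn G U l ∧ l.length = m}
  have hs : s.Nonempty := ⟨0, [], ⟨by simp, by simp, by simp⟩, rfl⟩
  have hbd : BddAbove s := ⟨Fintype.card V, by rintro _ ⟨l, hl, rfl⟩; exact hb l hl⟩
  obtain ⟨l, hl, hm⟩ := Nat.sSup_mem hs hbd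
  exact ⟨l, hl, fun l' hl' => hm ▸ le_csSup hbd ⟨l', hl', rfl⟩⟩

open Classical in
/-- Pósa's lemma. -/
theorem exists_ends_boundary_le [Fintype V] {G : SimpleGraph V} {U : Set V} {P : List V}
    (hP : IsLongestPathIn G U P) (hne : P ≠ []) :
    ∃ R : Finset V, R.Nonempty ∧ (∀ x ∈ R, x ∈ longestPathEnds G U) ∧
      (Finset.univ.filter fun w => w ∈ U ∧ w ∉ R ∧ ∃ x ∈ R, G.Adj x w).card ≤ 2 * R.card := by
  let R : Finset V := Finset.univ.filter fun x => ∃ Q, Rotated G P Q ∧ Q.head? = some x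
  have hR : ∀ x, x ∈ R ↔ ∃ Q, Rotated G P Q ∧ Q.head? = some x := by simp [R]
  refine ⟨R, ?_, ?_, ?_⟩
  · cases P with
    | nil => exact (hne rfl).elim
    | cons x P => exact ⟨x, (hR x).2 ⟨_, .refl, rfl⟩⟩
  · intro x hx
    obtain ⟨Q, hQ, hQx⟩ := (hR x).1 hx
    obtain ⟨l, rfl⟩ := List.head?_eq_some_iff.1 hQx
    exact ⟨l, hQ.isLongestPathIn hP⟩
  · have hsub : (Finset.univ.filter fun w => w ∈ U ∧ w ∉ R ∧ ∃ x ∈ R, G.Adj x w) ⊆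
        R.biUnion fun x => Finset.univ.filter fun w => ListAdj x w P := by
      intro y hy
      simp only [Finset.mem_filter, Finset.mem_univ, true_and, Finset.mem_biUnion] at hy ⊢
      obtain ⟨hyU, hyR, x, hx, hxy⟩ := hy
      -- If `y` is next to no member of `R` on `P`, it keeps its path neighbours under all
      -- rotations. But rotating `Q` along `x y` makes the predecessor `z` of `y` an end, so `z ∈ R`
      -- is such a neighbour.
      by_contra hcon
      push Not at hcon
      obtain ⟨Q, hQ, hQx⟩ := (hR x).1 hx
      have hQl := hQ.isLongestPathIn hP
      have hyQ : y ∈ Q := by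
        by_contra hyQ
        obtain ⟨l, rfl⟩ := List.head?_eq_some_iff.1 hQx
        have : IsPathIn G U (y :: x :: l) :=
          ⟨List.nodup_cons.2 ⟨hyQ, hQl.nodup⟩,
            List.isChain_cons_cons.2 ⟨hxy.symm, hQl.chain⟩, by
              intro a ha
              rcases List.mem_cons.1 ha with rfl | ha
              · exact hyU
              · exact hQl.subset a ha⟩
        have := hQl.length_le _ this
        simp at this
      obtain ⟨A, B, rfl⟩ := List.append_of_mem hyQ
      have hA : A.head? = some x := by
        cases A with
        | nil =>
          simp only [List.nil_append, List.head?_cons, Option.some.injEq] at hQx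
          exact (hyR (hQx ▸ hx)).elim
        | cons a A => simpa using hQx
      obtain ⟨z, hz⟩ : ∃ z, A.getLast? = some z := by
        cases A with
        | nil => simp at hA
        | cons a A => exact ⟨_, List.getLast?_eq_some_getLast (by simp)⟩
      have hzR : z ∈ R :=
        (hR z).2 ⟨_, .step A B x y hA hxy hQ, by simp [List.head?_append, hz]⟩
      refine hcon z hzR (ListAdj.symm ?_)
      rw [← hQ.listAdj_iff (fun Q' h' e => hyR ((hR y).2 ⟨Q', h', e⟩))
        (fun Q' z' h' e hadj => hcon z' ((hR z').2 ⟨Q', h', e⟩) hadj.symm) z, listAdj_append]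
      exact Or.inr (Or.inl ⟨z, hz, y, by simp, by simp⟩)
    refine (Finset.card_le_card hsub).trans ?_
    rw [mul_comm]
    exact Finset.card_biUnion_le_card_mul _ _ _ fun x _ => card_listAdj_le x hP.nodup

/-! ### Expansion and missing edges at a vertex off a longest path -/

/-- `G` has a path, given as a list, through all the vertices. -/
def HasSpanningList (G : SimpleGraph V) : Prop :=
  ∃ l : List V, l.Nodup ∧ l.IsChain G.Adj ∧ ∀ v, v ∈ l

open Classical in
/-- The outer boundary of `S` in `G`. -/
noncomputable def outerBoundary [Fintype V] (G : SimpleGraph V) (S : Finset V) : Finset V :=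
  Finset.univ.filter fun w => w ∉ S ∧ ∃ x ∈ S, G.Adj x w

/-- Every nonempty set of at most `m` vertices has an outer boundary more than twice as large. -/
def Expands [Fintype V] (G : SimpleGraph V) (m : ℕ) : Prop :=
  ∀ S : Finset V, S.Nonempty → S.card ≤ m → 2 * S.card + 2 ≤ (outerBoundary G S).card

theorem Expands.exists_nonadj [Fintype V] {G : SimpleGraph V} {m : ℕ} (hG : Expands G m)
    (hnot : ¬ HasSpanningList G) :
    ∃ v, ∃ R : Finset V, (R : Set V) = longestPathEnds G {v}ᶜ ∧ m < R.card ∧ v ∉ R ∧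
      ∀ r ∈ R, ¬ G.Adj v r := by
  classical
  obtain ⟨P, hP⟩ := exists_isLongestPathIn G Set.univ
  obtain ⟨v, hv⟩ : ∃ v, v ∉ P := by
    by_contra! h
    exact hnot ⟨P, hP.nodup, hP.chain, h⟩
  have hPv : IsLongestPathIn G {v}ᶜ P :=
    ⟨⟨hP.nodup, hP.chain, fun x hx => fun e => hv (e ▸ hx)⟩,
      fun l hl => hP.length_le l ⟨hl.nodup, hl.chain, fun _ _ => trivial⟩⟩
  have hne : P ≠ [] := by
    rintro rfl
    have := hP.length_le [v] ⟨by simp, by simp, fun _ _ => trivial⟩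
    simp at this
  refine ⟨v, (longestPathEnds G {v}ᶜ).toFinset, by simp, ?_, ?_, ?_⟩
  · obtain ⟨R, hRne, hR, hcard⟩ := exists_ends_boundary_le hPv hne
    have hle : R.card ≤ (longestPathEnds G {v}ᶜ).toFinset.card :=
      Finset.card_le_card fun x hx => by simpa using hR x hx
    refine lt_of_lt_of_le ?_ hle
    by_contra! hm
    have h1 := hG R hRne hm
    -- Passing to `G - v` loses at most the vertex `v`; the `+ 2` in `Expands` still leaves `2 *
    -- R.card + 1`, one more than Pósa allows.
    have h2 : outerBoundary G R ⊆ insert v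
        (Finset.univ.filter fun w => w ∈ ({v}ᶜ : Set V) ∧ w ∉ R ∧ ∃ x ∈ R, G.Adj x w) := by
      intro w hw
      simp only [outerBoundary, Finset.mem_filter, Finset.mem_univ, true_and] at hw
      by_cases hwv : w = v
      · simp [hwv]
      · simp only [Finset.mem_insert, Finset.mem_filter, Finset.mem_univ, true_and]
        exact Or.inr ⟨hwv, hw⟩
    have h3 := ((Finset.card_le_card h2).trans (Finset.card_insert_le _ _)).trans
      (Nat.add_le_add_right (m := 2 * R.card) (by convert hcard) 1)
    omega
  · simp only [Set.mem_toFinset]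
    rintro ⟨l, hl⟩
    exact hl.subset v (by simp) rfl
  · simp only [Set.mem_toFinset]
    rintro r ⟨l, hl⟩ hvr
    have h1 := hP.length_le (v :: r :: l)
      ⟨List.nodup_cons.2 ⟨fun h => hl.subset v h rfl, hl.nodup⟩,
        List.isChain_cons_cons.2 ⟨hvr, hl.chain⟩, fun _ _ => trivial⟩
    have h2 := hl.length_le P hPv.toIsPathIn
    simp only [List.length_cons] at h1 h2
    omega

/-- With `U = {v}ᶜ`, this is what makes the set of ends independent of the edges at `v`. -/
theorem longestPathEnds_congr {G H : SimpleGraph V} {U : Set V}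
    (h : ∀ a ∈ U, ∀ b ∈ U, (G.Adj a b ↔ H.Adj a b)) :
    longestPathEnds G U = longestPathEnds H U := by
  have key : ∀ l, IsPathIn G U l ↔ IsPathIn H U l := by
    have one : ∀ {G H : SimpleGraph V}, (∀ a ∈ U, ∀ b ∈ U, (G.Adj a b ↔ H.Adj a b)) →
        ∀ l, IsPathIn G U l → IsPathIn H U l := fun h l hl =>
      ⟨hl.nodup, List.IsChain.imp_of_mem_imp
        (fun a b ha hb hab => (h a (hl.subset a ha) b (hl.subset b hb)).1 hab) hl.chain, hl.subset⟩
    exact fun l => ⟨one h l, one (fun a ha b hb => (h a ha b hb).symm) l⟩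
  ext x
  refine exists_congr fun l => ⟨fun hl => ⟨(key _).1 hl.toIsPathIn, fun l' hl' =>
    hl.length_le l' ((key _).2 hl')⟩, fun hl => ⟨(key _).2 hl.toIsPathIn, fun l' hl' =>
    hl.length_le l' ((key _).1 hl')⟩⟩

theorem HasSpanningList.mono {G H : SimpleGraph V} (hGH : G ≤ H) (h : HasSpanningList G) :
    HasSpanningList H := by
  obtain ⟨l, h1, h2, h3⟩ := h
  exact ⟨l, h1, h2.imp fun a b hab => hGH hab, h3⟩

end Paths

theorem HasSpanningList.hasHamiltonianPath {n : ℕ} (hn : 1 ≤ n) {G : SimpleGraph (Fin n)}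
    (h : HasSpanningList G) : HasHamiltonianPath G := by
  obtain ⟨l, h1, h2, h3⟩ := h
  refine ⟨_, _, .ofSupport l (List.ne_nil_of_mem (h3 ⟨0, hn⟩)) h2, fun a => ?_⟩
  rw [SimpleGraph.Walk.support_ofSupport]
  exact List.count_eq_one_of_mem h1 (h3 a)

/-! ### The random graph for large `n` -/

section Model

variable {n : ℕ}

/-- The edge of `K_n` with the endpoints `a` and `b`. -/
def kEdge (a b : Fin n) (h : a ≠ b) : KEdge n := ⟨s(a, b), (SimpleGraph.mem_edgeSet _).2 h⟩

theorem openGraph_adj {z : KEdge n → Bool} {a b : Fin n} :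
    (openGraph z).Adj a b ↔ ∃ h : a ≠ b, z (kEdge a b h) = true := by
  rw [openGraph, SimpleGraph.fromEdgeSet_adj]
  constructor
  · rintro ⟨⟨f, hf, hz⟩, h⟩
    exact ⟨h, by rwa [← show f = kEdge a b h from Subtype.ext hf]⟩
  · rintro ⟨h, hz⟩
    exact ⟨⟨_, rfl, hz⟩, h⟩

variable {Ω : Type*} [MeasurableSpace Ω] {μ : Measure Ω} [IsProbabilityMeasure μ]
  {q : Sym2 (Fin n) → ℝ} {Z : KEdge n → Ω → Bool}

omit [IsProbabilityMeasure μ] in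
theorem IsEdgeModel.measureReal_forall_eq (hZ : IsEdgeModel μ q Z) (F : Finset (KEdge n))
    (b : Bool) : μ.real {ω | ∀ f ∈ F, Z f ω = b} = ∏ f ∈ F, μ.real {ω | Z f ω = b} := by
  have h := hZ.indep.meas_biInter (S := F) (s := fun f => {ω | Z f ω = b})
    fun f _ => ⟨{b}, MeasurableSet.of_discrete, rfl⟩
  have he : {ω | ∀ f ∈ F, Z f ω = b} = ⋂ f ∈ F, {ω | Z f ω = b} := by ext; simp
  rw [he, Measure.real, h, ENNReal.toReal_prod]
  rfl

theorem IsEdgeModel.measureReal_false (hZ : IsEdgeModel μ q Z) (f : KEdge n) :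
    μ.real {ω | Z f ω = false} = 1 - q f := by
  have he : {ω | Z f ω = false} = {ω | Z f ω = true}ᶜ := by ext; simp
  have hm : MeasurableSet {ω | Z f ω = true} := hZ.measurable f (MeasurableSet.singleton true)
  rw [he, probReal_compl_eq_one_sub hm, hZ.law]

/-- Independence and `1 - q ≤ e^(-q)`; disjointness ensures that distinct pairs in `S × W` are
distinct edges. -/
theorem IsEdgeModel.measureReal_no_edge_le (hZ : IsEdgeModel μ q Z)
    {S W : Finset (Fin n)} (hSW : Disjoint S W) :
    μ.real {ω | ∀ a ∈ S, ∀ b ∈ W, ¬ (openGraph fun f => Z f ω).Adj a b} ≤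
      Real.exp (-∑ a ∈ S, ∑ b ∈ W, q s(a, b)) := by
  classical
  let F : Finset (KEdge n) := Finset.univ.filter fun f => ∃ a ∈ S, ∃ b ∈ W, (f : Sym2 _) = s(a, b)
  have hne : ∀ x ∈ S ×ˢ W, x.1 ≠ x.2 := fun x hx =>
    Finset.disjoint_left.1 hSW |> fun h e => by
      rw [Finset.mem_product] at hx
      exact h hx.1 (e ▸ hx.2)
  have hsum : ∑ a ∈ S, ∑ b ∈ W, q s(a, b) = ∑ f ∈ F, q f := by
    rw [← Finset.sum_product']
    refine Finset.sum_bij (fun x hx => kEdge x.1 x.2 (hne x hx)) ?_ ?_ ?_ ?_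
    · intro x hx
      rw [Finset.mem_product] at hx
      simp only [F, Finset.mem_filter, Finset.mem_univ, true_and]
      exact ⟨x.1, hx.1, x.2, hx.2, rfl⟩
    · intro x hx y hy hxy
      have h := congrArg Subtype.val hxy
      simp only [kEdge, Sym2.eq_iff] at h
      rw [Finset.mem_product] at hx hy
      rcases h with h | h
      · exact Prod.ext h.1 h.2
      · exact (Finset.disjoint_left.1 hSW hx.1 (h.1 ▸ hy.2)).elim
    · intro f hf
      simp only [F, Finset.mem_filter, Finset.mem_univ, true_and] at hf
      obtain ⟨a, ha, b, hb, h⟩ := hf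
      exact ⟨(a, b), Finset.mem_product.2 ⟨ha, hb⟩, Subtype.ext h.symm⟩
    · intro x hx
      rfl
  have hsub : {ω | ∀ a ∈ S, ∀ b ∈ W, ¬ (openGraph fun f => Z f ω).Adj a b} ⊆
      {ω | ∀ f ∈ F, Z f ω = false} := by
    intro ω hω f hf
    simp only [F, Finset.mem_filter, Finset.mem_univ, true_and] at hf
    obtain ⟨a, ha, b, hb, h⟩ := hf
    have hab : a ≠ b := hne (a, b) (Finset.mem_product.2 ⟨ha, hb⟩)
    have h' := hω a ha b hb
    rw [openGraph_adj] at h'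
    push Not at h'
    rw [show f = kEdge a b hab from Subtype.ext h]
    simpa using h' hab
  refine (measureReal_mono hsub (measure_ne_top μ _)).trans ?_
  rw [hZ.measureReal_forall_eq, hsum, ← Finset.sum_neg_distrib, Real.exp_sum]
  refine Finset.prod_le_prod (fun _ _ => measureReal_nonneg) fun f _ => ?_
  rw [hZ.measureReal_false]
  linarith [Real.add_one_le_exp (-q f)]

theorem IsGoodAssignment.le_sum_sum {α c₁ c₂ p : ℝ} (hgood : IsGoodAssignment α c₁ c₂ p q)
    {S W : Finset (Fin n)} (hSW : Disjoint S W) (hW : α * n ≤ W.card) :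
    S.card * (c₁ * W.card * p) ≤ ∑ a ∈ S, ∑ b ∈ W, q s(a, b) := by
  rw [← nsmul_eq_mul]
  exact Finset.card_nsmul_le_sum _ _ _ fun a ha =>
    (hgood a W (Finset.disjoint_left.1 hSW ha) hW).1

theorem exists_sets_of_not_expands {G : SimpleGraph (Fin n)} (h : ¬ Expands G (n / 8)) :
    ∃ s ∈ Finset.Icc 1 (n / 8), ∃ S ∈ Finset.powersetCard s (Finset.univ : Finset (Fin n)),
      ∃ T ∈ Finset.powersetCard (3 * s) (Finset.univ : Finset (Fin n)),
        ∀ a ∈ S, ∀ b ∈ (S ∪ T)ᶜ, ¬ G.Adj a b := by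
  simp only [Expands] at h
  push Not at h
  obtain ⟨S, hne, hcard, hb⟩ := h
  have hpos := hne.card_pos
  -- The boundary has at most `2s + 1 ≤ 3s` vertices, as `s ≥ 1`; it is padded to exactly `3s`.
  obtain ⟨T, hT, hTc⟩ := Finset.exists_superset_card_eq (s := outerBoundary G S) (n := 3 * S.card)
    (by omega) (by simp; omega)
  refine ⟨S.card, Finset.mem_Icc.2 ⟨hpos, hcard⟩, S, by simp, T, by simp [hTc], ?_⟩
  intro a ha b hb hab
  simp only [Finset.mem_compl, Finset.mem_union, not_or] at hb
  refine hb.2 (hT ?_)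
  simp only [outerBoundary, Finset.mem_filter, Finset.mem_univ, true_and]
  exact ⟨hb.1, a, ha, hab⟩

/-- For each `s` there are at most `n^(4s)` pairs `(S, T)`. Since `4s ≤ n/2`, at least `n/2`
vertices lie outside `S ∪ T`, so each `s` contributes at most `x^s ≤ x`. -/
theorem IsEdgeModel.measureReal_not_expands_le {α c₁ c₂ p : ℝ} (hZ : IsEdgeModel μ q Z)
    (hgood : IsGoodAssignment α c₁ c₂ p q)
    (hα : α ≤ 1 / 2) (hc₁ : 0 ≤ c₁) (hp : 0 ≤ p)
    (hx : (n : ℝ) ^ 4 * Real.exp (-(c₁ * n * p / 2)) ≤ 1) :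
    μ.real {ω | ¬ Expands (openGraph fun f => Z f ω) (n / 8)} ≤
      n * ((n : ℝ) ^ 4 * Real.exp (-(c₁ * n * p / 2))) := by
  set x := (n : ℝ) ^ 4 * Real.exp (-(c₁ * n * p / 2)) with hxdef
  have hx0 : 0 ≤ x := by positivity
  have hsub : {ω | ¬ Expands (openGraph fun f => Z f ω) (n / 8)} ⊆
      ⋃ s ∈ Finset.Icc 1 (n / 8),
        ⋃ S ∈ Finset.powersetCard s (Finset.univ : Finset (Fin n)),
          ⋃ T ∈ Finset.powersetCard (3 * s) (Finset.univ : Finset (Fin n)),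
            {ω | ∀ a ∈ S, ∀ b ∈ (S ∪ T)ᶜ, ¬ (openGraph fun f => Z f ω).Adj a b} := by
    intro ω hω
    simpa only [Set.mem_iUnion, Set.mem_ofPred_eq, exists_prop] using exists_sets_of_not_expands hω
  have hone : ∀ s ∈ Finset.Icc 1 (n / 8),
      ∀ S ∈ Finset.powersetCard s (Finset.univ : Finset (Fin n)),
      ∀ T ∈ Finset.powersetCard (3 * s) (Finset.univ : Finset (Fin n)),
      μ.real {ω | ∀ a ∈ S, ∀ b ∈ (S ∪ T)ᶜ, ¬ (openGraph fun f => Z f ω).Adj a b} ≤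
        Real.exp (-(c₁ * n * p / 2)) ^ s := by
    intro s hs S hS T hT
    rw [Finset.mem_powersetCard] at hS hT
    rw [Finset.mem_Icc] at hs
    have hdisj : Disjoint S (S ∪ T)ᶜ :=
      (disjoint_compl_right (a := S ∪ T)).mono_left Finset.subset_union_left
    have hW : (n : ℝ) / 2 ≤ ((S ∪ T)ᶜ.card : ℝ) := by
      have h1 : n ≤ 2 * (S ∪ T)ᶜ.card := by
        have := Finset.card_union_le S T
        rw [Finset.card_compl, Fintype.card_fin]
        omega
      have : (n : ℝ) ≤ 2 * ((S ∪ T)ᶜ.card : ℝ) := by exact_mod_cast h1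
      linarith
    refine (hZ.measureReal_no_edge_le hdisj).trans ?_
    rw [← Real.exp_nat_mul, Real.exp_le_exp, mul_neg, neg_le_neg_iff]
    have hn0 : (0 : ℝ) ≤ n := n.cast_nonneg
    refine le_trans ?_ (hgood.le_sum_sum hdisj (by nlinarith))
    rw [hS.2]
    refine mul_le_mul_of_nonneg_left ?_ s.cast_nonneg
    calc c₁ * n * p / 2 = c₁ * (n / 2) * p := by ring
      _ ≤ _ := by gcongr
  calc _ ≤ ∑ s ∈ Finset.Icc 1 (n / 8),
        ∑ S ∈ Finset.powersetCard s (Finset.univ : Finset (Fin n)),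
          ∑ T ∈ Finset.powersetCard (3 * s) (Finset.univ : Finset (Fin n)),
            Real.exp (-(c₁ * n * p / 2)) ^ s := by
        refine (measureReal_mono hsub (measure_ne_top μ _)).trans
          ((measureReal_biUnion_finset_le _ _).trans ?_)
        refine Finset.sum_le_sum fun s hs => (measureReal_biUnion_finset_le _ _).trans ?_
        refine Finset.sum_le_sum fun S hS => (measureReal_biUnion_finset_le _ _).trans ?_
        exact Finset.sum_le_sum fun T hT => hone s hs S hS T hT
    _ ≤ ∑ s ∈ Finset.Icc 1 (n / 8), x := by
        refine Finset.sum_le_sum fun s hs => ?_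
        rw [Finset.mem_Icc] at hs
        simp only [Finset.sum_const, Finset.card_powersetCard, Finset.card_univ, Fintype.card_fin,
          nsmul_eq_mul]
        have h1 : (n.choose s : ℝ) ≤ (n : ℝ) ^ s := by exact_mod_cast Nat.choose_le_pow n s
        have h2 : (n.choose (3 * s) : ℝ) ≤ (n : ℝ) ^ (3 * s) := by
          exact_mod_cast Nat.choose_le_pow n (3 * s)
        calc _ ≤ (n : ℝ) ^ s * ((n : ℝ) ^ (3 * s) * Real.exp (-(c₁ * n * p / 2)) ^ s) := by gcongr
          _ = x ^ s := by rw [hxdef, mul_pow, ← pow_mul, ← mul_assoc, ← pow_add]; ring_nf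
          _ ≤ x := pow_le_of_le_one hx0 hx (by omega)
    _ ≤ n * x := by
        rw [Finset.sum_const, nsmul_eq_mul]
        gcongr
        simp only [Nat.card_Icc]
        omega

theorem IsEdgeModel.measureReal_ends_nonadj_le {α c₁ c₂ p : ℝ} (hZ : IsEdgeModel μ q Z)
    (hgood : IsGoodAssignment α c₁ c₂ p q)
    (hα : α ≤ 1 / 8) (hc₁ : 0 ≤ c₁) (hp : 0 ≤ p) (v : Fin n) :
    μ.real {ω | ∃ R : Finset (Fin n),
        (R : Set (Fin n)) = longestPathEnds (openGraph fun f => Z f ω) {v}ᶜ ∧ n / 8 < R.card ∧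
          v ∉ R ∧ ∀ r ∈ R, ¬ (openGraph fun f => Z f ω).Adj v r} ≤
      Real.exp (-(c₁ * n * p / 8)) := by
  classical
  let I : Finset (KEdge n) := Finset.univ.filter fun f => v ∈ (f : Sym2 (Fin n))
  let J : Finset (KEdge n) := Finset.univ.filter fun f => v ∉ (f : Sym2 (Fin n))
  have hIJ : Disjoint I J := Finset.disjoint_filter_filter_not _ _ _
  have hind := hZ.indep.indepFun_finset I J hIJ hZ.measurable
  have hmeas : ∀ K : Finset (KEdge n), Measurable fun ω (i : K) => Z i ω := fun K =>
    measurable_pi_lambda _ fun i => hZ.measurable i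
  let T : Finset (Fin n) → Set Ω := fun R =>
    {ω | (R : Set (Fin n)) = longestPathEnds (openGraph fun f => Z f ω) {v}ᶜ}
  let E : Finset (Fin n) → Set Ω := fun R =>
    {ω | ∀ r ∈ R, ¬ (openGraph fun f => Z f ω).Adj v r}
  -- The value `false` on edges through `v` is harmless: paths inside `{v}ᶜ` never use them.
  let ext : (J → Bool) → KEdge n → Bool := fun y f => if h : f ∈ J then y ⟨f, h⟩ else false
  have hT : ∀ R, T R = (fun ω (i : J) => Z i ω) ⁻¹'
      {y | (R : Set (Fin n)) = longestPathEnds (openGraph (ext y)) {v}ᶜ} := by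
    intro R
    ext ω
    simp only [T, Set.mem_preimage, Set.mem_ofPred_eq]
    rw [longestPathEnds_congr]
    intro a ha b hb
    rw [openGraph_adj, openGraph_adj]
    refine exists_congr fun hab => ?_
    have : kEdge a b hab ∈ J := by
      simp only [J, Finset.mem_filter, Finset.mem_univ, true_and, kEdge, Sym2.mem_iff, not_or]
      exact ⟨fun e => ha e.symm, fun e => hb e.symm⟩
    simp [ext, this]
  have hE : ∀ R, E R = (fun ω (i : I) => Z i ω) ⁻¹'
      {x | ∀ r ∈ R, ∀ h : v ≠ r, x ⟨kEdge v r h, by simp [I, kEdge]⟩ = false} := by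
    intro R
    ext ω
    simp only [E, Set.mem_preimage, Set.mem_ofPred_eq, openGraph_adj, not_exists,
      Bool.not_eq_true]
  have hTm : ∀ R, MeasurableSet (T R) := fun R => by
    rw [hT]
    exact hmeas J (Set.toFinite _).measurableSet
  have hmul : ∀ R, μ.real (T R ∩ E R) = μ.real (T R) * μ.real (E R) := by
    intro R
    rw [Set.inter_comm, mul_comm, hT, hE, Measure.real,
      hind.measure_inter_preimage_eq_mul _ _ (Set.toFinite _).measurableSet
        (Set.toFinite _).measurableSet, ENNReal.toReal_mul]
    rfl
  let 𝓡 : Finset (Finset (Fin n)) := Finset.univ.filter fun R => n / 8 < R.card ∧ v ∉ R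
  have hEle : ∀ R ∈ 𝓡, μ.real (E R) ≤ Real.exp (-(c₁ * n * p / 8)) := by
    intro R hR
    simp only [𝓡, Finset.mem_filter, Finset.mem_univ, true_and] at hR
    have hdisj : Disjoint {v} R := Finset.disjoint_singleton_left.2 hR.2
    have h := hZ.measureReal_no_edge_le hdisj
    simp only [Finset.mem_singleton, forall_eq, Finset.sum_singleton] at h
    refine h.trans (Real.exp_le_exp.2 (neg_le_neg ?_))
    have hcard : (n : ℝ) / 8 ≤ R.card := by
      have h1 : n ≤ 8 * R.card := by omega
      have : (n : ℝ) ≤ 8 * (R.card : ℝ) := by exact_mod_cast h1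
      linarith
    have hn0 : (0 : ℝ) ≤ n := n.cast_nonneg
    refine le_trans ?_ (hgood v R hR.2 (by nlinarith)).1
    calc c₁ * n * p / 8 = c₁ * (n / 8) * p := by ring
      _ ≤ _ := by gcongr
  have hsub : {ω | ∃ R : Finset (Fin n),
      (R : Set (Fin n)) = longestPathEnds (openGraph fun f => Z f ω) {v}ᶜ ∧ n / 8 < R.card ∧
        v ∉ R ∧ ∀ r ∈ R, ¬ (openGraph fun f => Z f ω).Adj v r} ⊆ ⋃ R ∈ 𝓡, T R ∩ E R := by
    rintro ω ⟨R, h1, h2, h3, h4⟩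
    simp only [Set.mem_iUnion]
    exact ⟨R, by simp [𝓡, h2, h3], h1, h4⟩
  -- The set of ends takes one value at a time, so the events `T R` are disjoint and summing over
  -- `R` costs nothing.
  have hsum : ∑ R ∈ 𝓡, μ.real (T R) ≤ 1 := by
    rw [← measureReal_biUnion_finset _ fun R _ => hTm R]
    · exact measureReal_le_one
    · intro R _ R' _ hne
      refine Set.disjoint_left.2 fun ω (h : _ = _) (h' : _ = _) => hne ?_
      exact Finset.coe_injective (h.trans h'.symm)
  calc _ ≤ ∑ R ∈ 𝓡, μ.real (T R ∩ E R) :=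
        (measureReal_mono hsub (measure_ne_top μ _)).trans (measureReal_biUnion_finset_le _ _)
    _ ≤ ∑ R ∈ 𝓡, μ.real (T R) * Real.exp (-(c₁ * n * p / 8)) := by
        refine Finset.sum_le_sum fun R hR => ?_
        rw [hmul]
        exact mul_le_mul_of_nonneg_left (hEle R hR) measureReal_nonneg
    _ ≤ _ := by
        rw [← Finset.sum_mul]
        exact mul_le_of_le_one_left (Real.exp_pos _).le hsum

theorem IsEdgeModel.one_sub_le_measureReal_hasHamiltonianPath {α c₁ c₂ p : ℝ}
    (hZ : IsEdgeModel μ q Z)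
    (hgood : IsGoodAssignment α c₁ c₂ p q) (hn : 1 ≤ n)
    (hα : α ≤ 1 / 8) (hc₁ : 0 ≤ c₁) (hp : 0 ≤ p)
    (hx : (n : ℝ) ^ 4 * Real.exp (-(c₁ * n * p / 2)) ≤ 1) :
    1 - (n * ((n : ℝ) ^ 4 * Real.exp (-(c₁ * n * p / 2))) + n * Real.exp (-(c₁ * n * p / 8))) ≤
      μ.real {ω | HasHamiltonianPath (openGraph fun f => Z f ω)} := by
  let H : Set Ω := {ω | HasHamiltonianPath (openGraph fun f => Z f ω)}
  let X : Set Ω := {ω | ¬ Expands (openGraph fun f => Z f ω) (n / 8)}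
  let B : Fin n → Set Ω := fun v => {ω | ∃ R : Finset (Fin n),
    (R : Set (Fin n)) = longestPathEnds (openGraph fun f => Z f ω) {v}ᶜ ∧ n / 8 < R.card ∧
      v ∉ R ∧ ∀ r ∈ R, ¬ (openGraph fun f => Z f ω).Adj v r}
  have hcover : (Set.univ : Set Ω) ⊆ H ∪ (X ∪ ⋃ v, B v) := by
    intro ω _
    by_cases h1 : HasSpanningList (openGraph fun f => Z f ω)
    · exact Or.inl (h1.hasHamiltonianPath hn)
    by_cases h2 : Expands (openGraph fun f => Z f ω) (n / 8)
    · exact Or.inr (Or.inr (Set.mem_iUnion.2 (h2.exists_nonadj h1)))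
    · exact Or.inr (Or.inl h2)
  have h1 : 1 ≤ μ.real (H ∪ (X ∪ ⋃ v, B v)) := by
    rw [← probReal_univ (μ := μ)]
    exact measureReal_mono hcover
  have h2 := measureReal_union_le (μ := μ) H (X ∪ ⋃ v, B v)
  have h3 := measureReal_union_le (μ := μ) X (⋃ v, B v)
  have h4 : μ.real X ≤ _ :=
    hZ.measureReal_not_expands_le hgood (by linarith) hc₁ hp hx
  have h5 : μ.real (⋃ v, B v) ≤ n * Real.exp (-(c₁ * n * p / 8)) := by
    refine (measureReal_iUnion_fintype_le _).trans ((Finset.sum_le_sum fun v _ =>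
      hZ.measureReal_ends_nonadj_le hgood hα hc₁ hp v).trans ?_)
    simp
  change _ ≤ μ.real H
  linarith

/-! ### A positive lower bound for small `n` -/

/-- The pairs whose probability is at least `t`. -/
def heavyGraph (q : Sym2 (Fin n) → ℝ) (t : ℝ) : SimpleGraph (Fin n) where
  Adj a b := a ≠ b ∧ t ≤ q s(a, b)
  symm := ⟨fun a b h => ⟨h.1.symm, Sym2.eq_swap (a := a) (b := b) ▸ h.2⟩⟩
  loopless := ⟨fun _ h => h.1 rfl⟩

/-- On a set of at least `αn` vertices the average of `q s(u, ·)` is at least `c₁p`, so its values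
cannot all be smaller. -/
theorem IsGoodAssignment.card_nonadj_lt {α c₁ c₂ p : ℝ} (hgood : IsGoodAssignment α c₁ c₂ p q)
    (hα : 0 < α) (hn : 1 ≤ n) {u : Fin n} {S : Finset (Fin n)} (hu : u ∉ S)
    (hS : ∀ v ∈ S, ¬ (heavyGraph q (c₁ * p)).Adj u v) : (S.card : ℝ) < α * n := by
  by_contra! hle
  have hn0 : (0 : ℝ) < n := by exact_mod_cast hn
  have hpos : (0 : ℝ) < S.card := lt_of_lt_of_le (by positivity) hle
  have hne : S.Nonempty := Finset.card_pos.1 (by exact_mod_cast hpos)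
  have h1 := (hgood u S hu hle).1
  have h2 : ∑ v ∈ S, q s(u, v) < ∑ v ∈ S, c₁ * p := by
    refine Finset.sum_lt_sum_of_nonempty hne fun v hv => ?_
    by_contra! h
    exact hS v hv ⟨fun e => hu (e ▸ hv), h⟩
  rw [Finset.sum_const, nsmul_eq_mul] at h2
  linarith [mul_right_comm c₁ (S.card : ℝ) p, mul_comm (c₁ * p) (S.card : ℝ)]

theorem IsGoodAssignment.hasSpanningList_heavyGraph {α c₁ c₂ p : ℝ}
    (hgood : IsGoodAssignment α c₁ c₂ p q) (hα : 0 < α) (hα' : α ≤ 1 / 6) (hn : 1 ≤ n) :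
    HasSpanningList (heavyGraph q (c₁ * p)) := by
  classical
  by_contra hnot
  have hn0 : (0 : ℝ) < n := by exact_mod_cast hn
  have hexp : Expands (heavyGraph q (c₁ * p)) ⌊α * n⌋₊ := by
    intro S hne hS
    have hS' : (S.card : ℝ) ≤ α * n := (Nat.le_floor_iff (by positivity)).1 hS
    have hpos : (1 : ℝ) ≤ S.card := by exact_mod_cast hne.card_pos
    obtain ⟨u, hu⟩ := hne
    let D : Finset (Fin n) :=
      Finset.univ.filter fun w => w ≠ u ∧ ¬ (heavyGraph q (c₁ * p)).Adj u w
    have hD : (D.card : ℝ) < α * n :=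
      hgood.card_nonadj_lt hα hn (u := u) (by simp [D]) (by simp [D])
    have hcov : (Finset.univ : Finset (Fin n)) ⊆
        S ∪ D ∪ outerBoundary (heavyGraph q (c₁ * p)) S := by
      intro w _
      by_cases hw : w ∈ S
      · simp [hw]
      by_cases hadj : (heavyGraph q (c₁ * p)).Adj u w
      · simp only [Finset.mem_union, outerBoundary, Finset.mem_filter, Finset.mem_univ, true_and]
        exact Or.inr ⟨hw, u, hu, hadj⟩
      · simp only [Finset.mem_union, D, Finset.mem_filter, Finset.mem_univ, true_and]
        exact Or.inl (Or.inr ⟨fun e => hw (e ▸ hu), hadj⟩)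
    have h1 := Finset.card_le_card hcov
    have h2 := Finset.card_union_le (S ∪ D) (outerBoundary (heavyGraph q (c₁ * p)) S)
    have h3 := Finset.card_union_le S D
    rw [Finset.card_univ, Fintype.card_fin] at h1
    have h4 : (n : ℝ) ≤ S.card + D.card + (outerBoundary (heavyGraph q (c₁ * p)) S).card := by
      exact_mod_cast (show n ≤ S.card + D.card + _ by omega)
    -- The boundary exceeds `n - 2αn ≥ 4αn ≥ 4s ≥ 2s + 2`, by `α ≤ 1/6` and `s ≥ 1`.
    have h5 : (2 * S.card + 2 : ℝ) ≤ (outerBoundary (heavyGraph q (c₁ * p)) S).card := by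
      nlinarith
    exact_mod_cast h5
  obtain ⟨v, R, -, hR, hv, hadj⟩ := hexp.exists_nonadj hnot
  have h1 := hgood.card_nonadj_lt hα hn hv hadj
  have h2 := (Nat.floor_lt (by positivity)).1 hR
  linarith

theorem IsEdgeModel.pow_le_measureReal_hasHamiltonianPath {α c₁ c₂ p : ℝ}
    (hZ : IsEdgeModel μ q Z) (hgood : IsGoodAssignment α c₁ c₂ p q) (hn : 1 ≤ n)
    (hα : 0 < α) (hα' : α ≤ 1 / 6) (h0 : 0 ≤ c₁ * p) (h1 : c₁ * p ≤ 1) :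
    (c₁ * p) ^ Fintype.card (KEdge n) ≤
      μ.real {ω | HasHamiltonianPath (openGraph fun f => Z f ω)} := by
  classical
  let F : Finset (KEdge n) := Finset.univ.filter fun f => c₁ * p ≤ q f
  have hsub : {ω | ∀ f ∈ F, Z f ω = true} ⊆
      {ω | HasHamiltonianPath (openGraph fun f => Z f ω)} := by
    intro ω hω
    refine ((hgood.hasSpanningList_heavyGraph hα hα' hn).mono ?_).hasHamiltonianPath hn
    intro a b hab
    exact openGraph_adj.2 ⟨hab.1, hω _ (by
      simp only [F, Finset.mem_filter, Finset.mem_univ, true_and]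
      exact hab.2)⟩
  refine le_trans ?_ (measureReal_mono hsub)
  rw [hZ.measureReal_forall_eq]
  calc (c₁ * p) ^ Fintype.card (KEdge n) ≤ (c₁ * p) ^ F.card :=
        pow_le_pow_of_le_one h0 h1 (Finset.card_le_univ _)
    _ = ∏ f ∈ F, c₁ * p := by simp
    _ ≤ _ := Finset.prod_le_prod (fun _ _ => h0) fun f hf => by
        rw [hZ.law]
        simpa [F] using hf

end Model

/-! ### Asymptotics and the choice of `θ` -/

theorem eventually_mul_pow_le_exp_rpow {a b : ℝ} (hb : 0 < b) (k m : ℕ)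
    (ha : a = 1 / ((k : ℝ) + 1)) :
    ∀ᶠ n : ℕ in Filter.atTop, 2 * (n : ℝ) ^ m ≤ Real.exp (b * (n : ℝ) ^ a) := by
  have hk : (0 : ℝ) < (k : ℝ) + 1 := by positivity
  have ha0 : 0 < a := by rw [ha]; positivity
  have h1 := (isLittleO_pow_exp_pos_mul_atTop (m * (k + 1)) hb).bound
    (show (0 : ℝ) < 1 / 2 by norm_num)
  have h2 : Filter.Tendsto (fun n : ℕ => (n : ℝ) ^ a) Filter.atTop Filter.atTop :=
    (tendsto_rpow_atTop ha0).comp tendsto_natCast_atTop_atTop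
  filter_upwards [h2.eventually h1] with n hn
  have h3 : ((n : ℝ) ^ a) ^ (m * (k + 1)) = (n : ℝ) ^ m := by
    rw [← Real.rpow_mul_natCast n.cast_nonneg, ← Real.rpow_natCast]
    congr 1
    rw [ha]
    push_cast
    field_simp
  rw [h3, Real.norm_of_nonneg (by positivity), Real.norm_of_nonneg (Real.exp_pos _).le] at hn
  linarith

theorem exists_pos_forall_lt_mul_le (N : ℕ) (x δ : ℕ → ℝ) (hδ : ∀ n, 1 ≤ n → 0 < δ n) {b : ℝ}
    (hb : 0 < b) : ∃ θ : ℝ, 0 < θ ∧ θ ≤ b ∧ ∀ n, 1 ≤ n → n < N → θ * x n ≤ δ n := by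
  have h1 : ∀ᶠ θ in nhdsWithin (0 : ℝ) (Set.Ioi 0), ∀ n ∈ Finset.Ico 1 N, θ * x n < δ n := by
    rw [Filter.eventually_all_finset]
    intro n hn
    have ht : Filter.Tendsto (fun θ : ℝ => θ * x n) (nhds 0) (nhds (0 * x n)) :=
      (continuous_id.mul continuous_const).tendsto 0
    rw [zero_mul] at ht
    exact (ht.eventually_lt_const (hδ n (Finset.mem_Ico.1 hn).1)).filter_mono nhdsWithin_le_nhds
  have h2 : ∀ᶠ θ in nhdsWithin (0 : ℝ) (Set.Ioi 0), θ < b :=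
    (eventually_lt_nhds hb).filter_mono nhdsWithin_le_nhds
  obtain ⟨θ, ⟨h1, h2⟩, h3⟩ := ((h1.and h2).and self_mem_nhdsWithin).exists
  exact ⟨θ, h3, h2.le, fun n hn hnN => (h1 n (Finset.mem_Ico.2 ⟨hn, hnN⟩)).le⟩

theorem add_mul_exp_le_of_two_mul_pow_le {n : ℕ} (hn : 1 ≤ n) {y : ℝ}
    (h : 2 * (n : ℝ) ^ 5 ≤ Real.exp (y / 16)) :
    (n : ℝ) ^ 4 * Real.exp (-(y / 2)) ≤ 1 ∧
      n * ((n : ℝ) ^ 4 * Real.exp (-(y / 2))) + n * Real.exp (-(y / 8)) ≤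
        Real.exp (-(y / 16)) := by
  have hn1 : (1 : ℝ) ≤ n := by exact_mod_cast hn
  set E := Real.exp (-(y / 16)) with hE
  have hE0 : 0 < E := Real.exp_pos _
  have h1 : 2 * (n : ℝ) ^ 5 * E ≤ 1 := by
    rw [hE, Real.exp_neg, ← div_eq_mul_inv]
    exact (div_le_one (Real.exp_pos _)).2 h
  have h2 : Real.exp (-(y / 2)) = E ^ 8 := by
    rw [hE, ← Real.exp_nat_mul]
    congr 1
    push_cast
    ring
  have h3 : Real.exp (-(y / 8)) = E ^ 2 := by
    rw [hE, ← Real.exp_nat_mul]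
    congr 1
    push_cast
    ring
  have h5 : (n : ℝ) ≤ (n : ℝ) ^ 5 := le_self_pow₀ hn1 (by norm_num)
  have h4 : (n : ℝ) ^ 4 ≤ (n : ℝ) ^ 5 := pow_le_pow_right₀ hn1 (by norm_num)
  have hE1 : E ≤ 1 := by nlinarith
  have h8 : E ^ 8 ≤ E ^ 2 := pow_le_pow_of_le_one hE0.le hE1 (by norm_num)
  -- Each of the two error terms is at most `n^5 E^2`, hence at most half of `E`.
  have h7 : (n : ℝ) ^ 5 * E ^ 2 ≤ E / 2 := by nlinarith
  rw [h2, h3]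
  constructor
  · calc (n : ℝ) ^ 4 * E ^ 8 ≤ (n : ℝ) ^ 5 * E ^ 2 := by gcongr
      _ ≤ 1 := by linarith
  · calc n * ((n : ℝ) ^ 4 * E ^ 8) + n * E ^ 2 = (n : ℝ) ^ 5 * E ^ 8 + n * E ^ 2 := by ring
      _ ≤ (n : ℝ) ^ 5 * E ^ 2 + (n : ℝ) ^ 5 * E ^ 2 := by gcongr
      _ ≤ E := by linarith

theorem theorem1 (k : ℕ) (hk : 1 ≤ k) (α c₁ c₂ C : ℝ)
    (hα0 : 0 < α) (hα1 : α < 1) (hc₁ : 0 < c₁) (hc₂ : 0 < c₂) (hc : c₁ ≤ c₂) (hC : 0 < C)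
    (hCle : C ≤ 1 / (10 * c₂)) (hαle : α ≤ min (7 / 8) ((C * c₁ / 8) ^ (k + 1))) :
    ∃ θ : ℝ, 0 < θ ∧
      ∀ (n : ℕ), 1 ≤ n → ∀ (p : ℝ), p = C * (n : ℝ) ^ (-((k : ℝ) / ((k : ℝ) + 1))) →
      ∀ (q : Sym2 (Fin n) → ℝ), (∀ f : KEdge n, 0 ≤ q f ∧ q f ≤ 1) →
        IsGoodAssignment α c₁ c₂ p q →
      ∀ (Ω : Type*) [MeasurableSpace Ω] (μ : Measure Ω) [IsProbabilityMeasure μ]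
        (Z : KEdge n → Ω → Bool), IsEdgeModel μ q Z →
        1 - Real.exp (-(θ * (n : ℝ) * p)) ≤
          μ.real {ω | HasHamiltonianPath (openGraph fun f => Z f ω)} := by
  have hCc : C * c₁ ≤ 1 / 10 := by
    rw [le_div_iff₀ (by positivity)] at hCle
    nlinarith
  -- `C * c₁ / 8 ≤ 1/80`, and a positive power of it is no larger; both regimes need only `α ≤ 1/8`.
  have hα : α ≤ 1 / 80 := by
    refine (hαle.trans (min_le_right _ _)).trans ?_
    have h0 : 0 ≤ C * c₁ / 8 := by positivity
    exact (pow_le_of_le_one h0 (by linarith) (by omega)).trans (by linarith)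
  let P : ℕ → ℝ := fun n => C * (n : ℝ) ^ (-((k : ℝ) / ((k : ℝ) + 1)))
  have hP0 : ∀ n : ℕ, 1 ≤ n → 0 < P n := fun n hn =>
    mul_pos hC (Real.rpow_pos_of_pos (by exact_mod_cast hn) _)
  have hnP : ∀ n : ℕ, 1 ≤ n → n * P n = C * (n : ℝ) ^ (1 / ((k : ℝ) + 1)) := by
    intro n hn
    have hn0 : (0 : ℝ) < n := by exact_mod_cast hn
    have hk0 : (k : ℝ) + 1 ≠ 0 := by positivity
    simp only [P]
    rw [mul_left_comm, ← Real.rpow_one_add' hn0.le (by field_simp; simpa using hk0)]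
    congr 2
    field_simp
    ring
  obtain ⟨N, hN⟩ := Filter.eventually_atTop.1
    (eventually_mul_pow_le_exp_rpow (b := c₁ * C / 16) (by positivity) k 5 rfl)
  obtain ⟨θ, hθ0, hθb, hθ⟩ := exists_pos_forall_lt_mul_le N (fun n => n * P n)
    (fun n => (c₁ * P n) ^ Fintype.card (KEdge n))
    (fun n hn => pow_pos (mul_pos hc₁ (hP0 n hn)) _) (show 0 < c₁ / 16 by positivity)
  refine ⟨θ, hθ0, ?_⟩
  rintro n hn p rfl q hq hgood Ω _ μ _ Z hZ
  change IsGoodAssignment α c₁ c₂ (P n) q at hgood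
  change 1 - Real.exp (-(θ * n * P n)) ≤ _
  have hp := hP0 n hn
  have hn1 : (1 : ℝ) ≤ n := by exact_mod_cast hn
  by_cases hnN : n < N
  · have hpC : P n ≤ C := mul_le_of_le_one_right hC.le
      (Real.rpow_le_one_of_one_le_of_nonpos hn1 (neg_nonpos.2 (by positivity)))
    have h1 := hZ.pow_le_measureReal_hasHamiltonianPath hgood hn hα0 (by linarith) (by positivity)
      (show c₁ * P n ≤ 1 by nlinarith)
    have h2 := hθ n hn hnN
    have h3 := Real.add_one_le_exp (-(θ * n * P n))
    -- For `n < N`: `1 - e^(-t) ≤ t` with `t = θnp`, and `θ` was chosen so that `t` is below the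
    -- positive lower bound.
    simp only [← mul_assoc] at h2
    linarith
  · have h1 := hN n (not_lt.1 hnN)
    rw [show c₁ * C / 16 * (n : ℝ) ^ (1 / ((k : ℝ) + 1)) = c₁ * n * P n / 16 by
      rw [mul_assoc c₁, hnP n hn]; ring] at h1
    obtain ⟨h2, h3⟩ := add_mul_exp_le_of_two_mul_pow_le hn h1
    have h4 := hZ.one_sub_le_measureReal_hasHamiltonianPath hgood hn (by linarith) hc₁.le hp.le h2
    have h5 : Real.exp (-(c₁ * n * P n / 16)) ≤ Real.exp (-(θ * n * P n)) := by
      refine Real.exp_le_exp.2 (neg_le_neg ?_)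
      calc θ * n * P n ≤ c₁ / 16 * n * P n := by gcongr
        _ = _ := by ring
    linarith
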